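/- Let $H$ be a finite Heyting algebra. An $H$-algebra is a Heyting algebra homomorphism $c\colon H\to A$; a morphism from $c\colon H\to A$ to $c'\colon H\to A'$ is a Heyting algebra homomorphism $\beta\colon A\to A'$ with $\beta\circ c=c'$. Regard $H$-algebras as algebras in the signature of Heyting algebras extended by one constant $c_h$ for each $h\in H$, and let the variety of étale $H$-algebras be the variety of $H$-algebras generated by $\mathrm{id}_H\colon H\to H$, that is, the smallest class of $H$-algebras containing $\mathrm{id}_H$ and closed under direct products, subalgebras and homomorphic images; it is regarded as a full subcategory of the category of $H$-algebras. Let $c_1\colon H\to H_1$ and $c_2\colon H\to H_2$ be étale $H$-algebras. Then $c_1$ and $c_2$ have a coproduct in the category of étale $H$-algebras, and for every such coproduct $c\colon H\to C$ with injections $\iota_i\colon H_i\to C$ ($i=1,2$), the lattice $C$ together with $\iota_1,\iota_2$ is a pushout of $c_1$ and $c_2$ in the category of bounded distributive lattices and bounded lattice homomorphisms, and also in the category of distributive lattices and all lattice homomorphisms. In particular $C$ is isomorphic to the pushout of $c_1$ and $c_2$ computed in distributive lattices. -/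

import Mathlib

open CategoryTheory CategoryTheory.Limits

universe u

/-- The category of `H`-algebras: objects are Heyting algebra homomorphisms `H ⟶ A`, morphisms are
Heyting algebra homomorphisms commuting with the maps from `H`. -/
abbrev HAlg (H : HeytAlg.{u}) : Type (u + 1) := Under H

namespace HAlg

variable {H : HeytAlg.{u}}

/-- The structure map `H ⟶ A` of an `H`-algebra, sending `h` to the constant `c_h`. -/
abbrev str (A : HAlg H) : H ⟶ A.right := A.hom

/-- The identity map of `H`, viewed as an `H`-algebra. -/
abbrev self (H : HeytAlg.{u}) : HAlg H := Under.mk (𝟙 H)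

/-- The direct product of a family of `H`-algebras: pointwise operations and pointwise constants. -/
def prod {ι : Type u} (A : ι → HAlg H) : HAlg H :=
  Under.mk (Y := HeytAlg.of (∀ i, (A i).right)) <| HeytAlg.ofHom
    { toFun := fun h i => (A i).str h
      map_sup' := fun a b => funext fun i => map_sup (A i).str.hom a b
      map_inf' := fun a b => funext fun i => map_inf (A i).str.hom a b
      map_bot' := funext fun i => map_bot (A i).str.hom
      map_himp' := fun a b => funext fun i => map_himp (A i).str.hom a b }

/-- A variety of `H`-algebras: a nonempty class of `H`-algebras closed under direct products,
subalgebras and homomorphic images (subalgebras and images are taken up to isomorphism). -/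
structure IsVariety (P : ObjectProperty (HAlg H)) : Prop where
  nonempty : ∃ A, P A
  prod : ∀ {ι : Type u} (A : ι → HAlg H), (∀ i, P (A i)) → P (HAlg.prod A)
  sub : ∀ {A B : HAlg H} (f : A ⟶ B), Function.Injective f.right → P B → P A
  image : ∀ {A B : HAlg H} (f : A ⟶ B), Function.Surjective f.right → P A → P B

end HAlg

/-- An `H`-algebra is étale if it lies in the variety of `H`-algebras generated by the identity of
`H`, i.e. in every variety of `H`-algebras that contains the identity of `H`. -/
def IsEtale (H : HeytAlg.{u}) : ObjectProperty (HAlg H) := fun A =>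
  ∀ P : ObjectProperty (HAlg H), HAlg.IsVariety P → P (HAlg.self H) → P A

/-- The category of étale `H`-algebras, a full subcategory of the category of `H`-algebras. -/
abbrev EtaleAlg (H : HeytAlg.{u}) : Type (u + 1) := (IsEtale H).FullSubcategory

namespace EtaleAlg

/-- The underlying bounded distributive lattice of an étale `H`-algebra. -/
abbrev toBddDistLat (H : HeytAlg.{u}) : EtaleAlg H ⥤ BddDistLat.{u} :=
  (IsEtale H).ι ⋙ Under.forget H ⋙ forget₂ HeytAlg BddDistLat

/-- The étale homomorphism `H ⟶ A` defining an étale `H`-algebra, as a bounded lattice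
homomorphism. -/
abbrev latStr {H : HeytAlg.{u}} (c : EtaleAlg H) :
    (forget₂ HeytAlg BddDistLat).obj H ⟶ (toBddDistLat H).obj c :=
  (forget₂ HeytAlg BddDistLat).map c.obj.str

end EtaleAlg

/-! Étale algebras satisfy the identity `⋁ h, x ⇔ c h = ⊤`: it holds in `H` and, the join being
finite, passes to products, subalgebras and images (`HAlg.isVariety_isLocallyConst`). Thus every
element is locally a constant, which has two consequences.

Implication reduces to lattice operations: below `(x ⇔ c h) ⊓ (y ⇔ c k)`, `x ⇨ y` agrees with `c (h
⇨ k)`. So a sublattice that contains the constants and the comparisons of its generators with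
constants is closed under `⇨` (`LatticeSpan.himp`). Moreover, a prime filter of `A` has a principal
trace on `H`, with generator `m` say, and is the preimage of `⊤` under a morphism from `A` to the
quotient of `H` by `m` (`primeEvalHom`).

The coproduct is the sublattice generated by `A` and `B` in the product of quotients of `H` over all
pairs of morphisms to a common quotient; by the first fact it is an étale algebra. Given lattice
maps `f`, `g` to `D` that agree on `H`, the sublattice generated by the pairs `(inl a, f a)` and
`(inr b, g b)` is a monotone relation (`HAlg.descSet_mono`): a failure would be seen by a prime
filter of `D`, whose pullbacks to `A` and `B` have the same trace on `H` and so yield one of these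
pairs of morphisms. Hence it is the graph of a lattice map. For étale targets the first fact closes
the graph under `⇨`, so the same lattice is the étale coproduct, and every other coproduct is
isomorphic to it. -/

open scoped symmDiff

/-! ### Congruences of a Heyting algebra -/

section Heyting

variable {A : Type*} [HeytingAlgebra A]

/-- `x ⇔ y` is the largest element below which `x` and `y` agree; all local computations go through
this. -/
lemma le_bihimp_iff_inf_eq {x y z : A} : z ≤ x ⇔ y ↔ x ⊓ z = y ⊓ z := by
  rw [bihimp, le_inf_iff, le_himp_iff, le_himp_iff]
  constructor
  · rintro ⟨h₁, h₂⟩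
    exact le_antisymm (le_inf (inf_comm x z ▸ h₂) inf_le_right)
      (le_inf (inf_comm y z ▸ h₁) inf_le_right)
  · intro h
    exact ⟨by rw [inf_comm, ← h]; exact inf_le_left, by rw [inf_comm, h]; exact inf_le_left⟩

lemma inf_bihimp_eq (x y : A) : x ⊓ (x ⇔ y) = y ⊓ (x ⇔ y) :=
  le_bihimp_iff_inf_eq.1 le_rfl

variable {x x' y y' z : A}

lemma inf_inf_congr (hx : x ⊓ z = x' ⊓ z) (hy : y ⊓ z = y' ⊓ z) :
    (x ⊓ y) ⊓ z = (x' ⊓ y') ⊓ z := by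
  rw [inf_inf_distrib_right, hx, hy, ← inf_inf_distrib_right]

lemma sup_inf_congr (hx : x ⊓ z = x' ⊓ z) (hy : y ⊓ z = y' ⊓ z) :
    (x ⊔ y) ⊓ z = (x' ⊔ y') ⊓ z := by
  rw [inf_sup_right, hx, hy, ← inf_sup_right]

lemma himp_inf_congr_le (hx : x ⊓ z = x' ⊓ z) (hy : y ⊓ z = y' ⊓ z) :
    (x ⇨ y) ⊓ z ≤ (x' ⇨ y') ⊓ z := by
  refine le_inf (le_himp_iff.2 ?_) inf_le_right
  have h : (x ⇨ y) ⊓ z ⊓ x' ≤ y ⊓ z := by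
    rw [inf_assoc, inf_comm z x', ← hx, ← inf_assoc]
    exact inf_le_inf_right z himp_inf_le
  exact (h.trans hy.le).trans inf_le_left

lemma himp_inf_congr (hx : x ⊓ z = x' ⊓ z) (hy : y ⊓ z = y' ⊓ z) :
    (x ⇨ y) ⊓ z = (x' ⇨ y') ⊓ z :=
  le_antisymm (himp_inf_congr_le hx hy) (himp_inf_congr_le hx.symm hy.symm)

lemma bihimp_inf_congr (hx : x ⊓ z = x' ⊓ z) (hy : y ⊓ z = y' ⊓ z) :
    (x ⇔ y) ⊓ z = (x' ⇔ y') ⊓ z :=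
  inf_inf_congr (himp_inf_congr hy hx) (himp_inf_congr hx hy)

/-- The principal ideal of elements below `f` is the quotient of a Heyting algebra by the filter
generated by `f`. -/
instance Set.Iic.instHeytingAlgebra (f : A) : HeytingAlgebra (Set.Iic f) :=
  { (inferInstance : Lattice (Set.Iic f)), (inferInstance : BoundedOrder (Set.Iic f)) with
    himp := fun a b => ⟨((a : A) ⇨ b) ⊓ f, inf_le_right⟩
    compl := fun a => ⟨((a : A) ⇨ ⊥) ⊓ f, inf_le_right⟩
    le_himp_iff := fun a b c => by
      change (a : A) ≤ ((b : A) ⇨ c) ⊓ f ↔ (a : A) ⊓ b ≤ c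
      rw [le_inf_iff, le_himp_iff, and_iff_left (show (a : A) ≤ f from a.2)]
    himp_bot := fun a => rfl }

/-- The quotient map onto the quotient by the filter generated by `f`. -/
def HeytingHom.toIic (f : A) : HeytingHom A (Set.Iic f) where
  toFun x := ⟨x ⊓ f, inf_le_right⟩
  map_sup' x y := Subtype.ext (inf_sup_right x y f)
  map_inf' x y := Subtype.ext (inf_inf_distrib_right x y f)
  map_bot' := Subtype.ext (bot_inf_eq f)
  map_himp' x y := Subtype.ext <|
    himp_inf_congr (by rw [inf_assoc, inf_idem]) (by rw [inf_assoc, inf_idem])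

lemma HeytingHom.toIic_surjective (f : A) : Function.Surjective (HeytingHom.toIic f) :=
  fun x => ⟨x, Subtype.ext (inf_eq_left.2 x.2)⟩

/-- The pairing of two Heyting homomorphisms. -/
def HeytingHom.pair {B C : Type*} [HeytingAlgebra B] [HeytingAlgebra C] (f : HeytingHom A B)
    (g : HeytingHom A C) : HeytingHom A (B × C) where
  toFun x := (f x, g x)
  map_sup' x y := Prod.ext (map_sup f x y) (map_sup g x y)
  map_inf' x y := Prod.ext (map_inf f x y) (map_inf g x y)
  map_bot' := Prod.ext (map_bot f) (map_bot g)
  map_himp' x y := Prod.ext (map_himp f x y) (map_himp g x y)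

end Heyting

/-! ### Algebras whose elements are locally constants -/

section LocallyConstant

variable {H A B : Type*} [HeytingAlgebra H] [Fintype H] [HeytingAlgebra A] [HeytingAlgebra B]

/-- Every element of `A` is locally equal to a constant from `H`. -/
def IsLocallyConst (c : HeytingHom H A) : Prop :=
  ∀ x, Finset.univ.sup (fun h => x ⇔ c h) = ⊤

lemma IsLocallyConst.id : IsLocallyConst (HeytingHom.id H) := fun x =>
  top_le_iff.1 ((bihimp_self x).symm.le.trans
    (Finset.le_sup (f := fun h => x ⇔ HeytingHom.id H h) (Finset.mem_univ x)))

lemma IsLocallyConst.pair {c : HeytingHom H A} {d : HeytingHom H B} (hc : IsLocallyConst c)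
    (hd : IsLocallyConst d) : IsLocallyConst (c.pair d) := by
  intro x
  refine Prod.ext ?_ ?_
  · refine Eq.trans ?_ (hc x.1)
    exact Finset.apply_sup_eq_sup_comp (Prod.fst : A × B → A) (fun _ _ => rfl) rfl
  · refine Eq.trans ?_ (hd x.2)
    exact Finset.apply_sup_eq_sup_comp (Prod.snd : A × B → B) (fun _ _ => rfl) rfl

/-- The elements obtained from `S` by finitely many lattice operations. -/
inductive LatticeSpan {A : Type*} [Lattice A] (S : Set A) : A → Prop
  | of {x : A} : x ∈ S → LatticeSpan S x
  | sup {x y : A} : LatticeSpan S x → LatticeSpan S y → LatticeSpan S (x ⊔ y)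
  | inf {x y : A} : LatticeSpan S x → LatticeSpan S y → LatticeSpan S (x ⊓ y)

section Span

variable {c : HeytingHom H A} (hc : IsLocallyConst c) {S : Set A}
  (hH : ∀ h, LatticeSpan S (c h))

include hc hH

/-- Meeting `y` with the cover of `⊤` by the `x ⇔ c h` writes it as a finite join of its pieces. The
empty join is the constant `c ⊥`. -/
lemma LatticeSpan.of_locally (x : A) {y : A} (hy : ∀ h, LatticeSpan S (y ⊓ (x ⇔ c h))) :
    LatticeSpan S y := by
  rw [← inf_top_eq y, ← hc x, Finset.sup_inf_distrib_left]
  refine Finset.sup_induction ?_ (fun _ ha _ hb => ha.sup hb) fun h _ => hy h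
  rw [← map_bot c]
  exact hH ⊥

/-- Here `w` is an operation applied to `x` and `y`, and `w'` is the same operation on constants.
Refining by the covers of both `x` and `y` makes `w` constant on each piece. -/
lemma LatticeSpan.of_locally₂ {x y w : A} (w' : H → H → H) (hx : ∀ h, LatticeSpan S (x ⇔ c h))
    (hy : ∀ h, LatticeSpan S (y ⇔ c h))
    (hw : ∀ h k z, x ⊓ z = c h ⊓ z → y ⊓ z = c k ⊓ z → w ⊓ z = c (w' h k) ⊓ z) :
    LatticeSpan S w := by
  refine LatticeSpan.of_locally hc hH x fun h => LatticeSpan.of_locally hc hH y fun k => ?_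
  rw [inf_assoc, hw h k _ (le_bihimp_iff_inf_eq.1 inf_le_left) (le_bihimp_iff_inf_eq.1 inf_le_right)]
  exact (hH _).inf ((hx h).inf (hy k))

lemma LatticeSpan.bihimp (hS : ∀ x ∈ S, ∀ h, LatticeSpan S (x ⇔ c h)) {x : A}
    (hx : LatticeSpan S x) : ∀ h, LatticeSpan S (x ⇔ c h) := by
  induction hx with
  | of hx => exact hS _ hx
  | sup _ _ ihx ihy =>
    intro l
    refine LatticeSpan.of_locally₂ hc hH (fun h k => (h ⊔ k) ⇔ l) ihx ihy fun h k z h₁ h₂ => ?_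
    rw [map_bihimp, map_sup]
    exact bihimp_inf_congr (sup_inf_congr h₁ h₂) rfl
  | inf _ _ ihx ihy =>
    intro l
    refine LatticeSpan.of_locally₂ hc hH (fun h k => (h ⊓ k) ⇔ l) ihx ihy fun h k z h₁ h₂ => ?_
    rw [map_bihimp, map_inf]
    exact bihimp_inf_congr (inf_inf_congr h₁ h₂) rfl

/-- Over a locally constant algebra, a lattice span that is closed under comparison of generators
with constants is closed under implication. -/
lemma LatticeSpan.himp (hS : ∀ x ∈ S, ∀ h, LatticeSpan S (x ⇔ c h)) {x y : A}
    (hx : LatticeSpan S x) (hy : LatticeSpan S y) : LatticeSpan S (x ⇨ y) := by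
  refine LatticeSpan.of_locally₂ hc hH (fun h k => h ⇨ k) (hx.bihimp hc hH hS)
    (hy.bihimp hc hH hS) fun h k z h₁ h₂ => ?_
  rw [map_himp]
  exact himp_inf_congr h₁ h₂

end Span

/-! ### Prime filters of a locally constant algebra -/

section Prime

variable (c : HeytingHom H A) (P : LatticeHom A Prop)

open Classical in
/-- The generator of the filter of `H` induced by a prime filter of `A`. -/
noncomputable def primeGen (p : H → Prop) : H :=
  (Finset.univ.filter p).inf id

variable {c P}

/-- Filters of a finite `H` are principal. `hP` covers the empty meet; `P ⊥` is not excluded, so the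
filter may be improper. -/
lemma primeGen_le_iff (hP : P ⊤) {h : H} : primeGen (fun h => P (c h)) ≤ h ↔ P (c h) := by
  classical
  constructor
  · intro hle
    have hgen : P (c (primeGen fun h => P (c h))) := by
      unfold primeGen
      refine Finset.inf_induction (p := fun h => P (c h)) (by rwa [map_top]) ?_ ?_
      · intro a ha b hb
        rw [map_inf, map_inf]
        exact ⟨ha, hb⟩
      · intro b hb
        exact (Finset.mem_filter.1 hb).2
    exact OrderHomClass.mono P (OrderHomClass.mono c hle) hgen
  · intro hh
    exact Finset.inf_le (f := id) (Finset.mem_filter.2 ⟨Finset.mem_univ h, hh⟩)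

/-- A prime filter containing the finite join `⊤` contains one of its members. -/
lemma IsLocallyConst.exists_bihimp (hc : IsLocallyConst c) (hP : P ⊤) (x : A) :
    ∃ h, P (x ⇔ c h) := by
  by_contra! hne
  rw [← hc x] at hP
  refine Finset.sup_induction (p := fun a => ¬ P a) ?_ ?_ (fun h _ => hne h) hP
  -- The filter may be improper, but then it contains every comparison.
  · exact fun hb => hne ⊥ (OrderHomClass.mono P bot_le hb)
  · intro a ha b hb
    rw [map_sup]
    exact not_or.2 ⟨ha, hb⟩

/-- This makes `primeEval` independent of the chosen constant. -/
lemma inf_primeGen_eq (hP : P ⊤) {x : A} {h k : H} (hh : P (x ⇔ c h)) (hk : P (x ⇔ c k)) :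
    h ⊓ primeGen (fun h => P (c h)) = k ⊓ primeGen (fun h => P (c h)) := by
  refine le_bihimp_iff_inf_eq.1 ((primeGen_le_iff hP).2 ?_)
  rw [map_bihimp]
  have hz : P ((x ⇔ c h) ⊓ (x ⇔ c k)) := by
    rw [map_inf]
    exact ⟨hh, hk⟩
  refine OrderHomClass.mono P (le_bihimp_iff_inf_eq.2 ?_) hz
  exact (le_bihimp_iff_inf_eq.1 inf_le_left).symm.trans (le_bihimp_iff_inf_eq.1 inf_le_right)

/-- The value at a prime filter, in the corresponding quotient of `H`, of an element of a locally
constant algebra. -/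
noncomputable def primeEval (hc : IsLocallyConst c) (hP : P ⊤) (x : A) :
    Set.Iic (primeGen fun h => P (c h)) :=
  HeytingHom.toIic _ (hc.exists_bihimp hP x).choose

lemma primeEval_eq (hc : IsLocallyConst c) (hP : P ⊤) {x : A} {h : H} (hh : P (x ⇔ c h)) :
    primeEval hc hP x = HeytingHom.toIic _ h :=
  Subtype.ext (inf_primeGen_eq hP (hc.exists_bihimp hP x).choose_spec hh)

lemma primeEval_const (hc : IsLocallyConst c) (hP : P ⊤) (h : H) :
    primeEval hc hP (c h) = HeytingHom.toIic _ h :=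
  primeEval_eq hc hP (by rwa [bihimp_self])

/-- Treats `⊔`, `⊓` and `⇨` uniformly: constants representing the arguments also represent the
result. -/
lemma primeEval_op (hc : IsLocallyConst c) (hP : P ⊤) {x y w : A} (w' : H → H → H)
    (hw : ∀ h k z, x ⊓ z = c h ⊓ z → y ⊓ z = c k ⊓ z → w ⊓ z = c (w' h k) ⊓ z) :
    ∃ h k, primeEval hc hP x = HeytingHom.toIic _ h ∧ primeEval hc hP y = HeytingHom.toIic _ k ∧
      primeEval hc hP w = HeytingHom.toIic _ (w' h k) := by
  obtain ⟨h, hh⟩ := hc.exists_bihimp hP x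
  obtain ⟨k, hk⟩ := hc.exists_bihimp hP y
  refine ⟨h, k, primeEval_eq hc hP hh, primeEval_eq hc hP hk, primeEval_eq hc hP ?_⟩
  have hz : P ((x ⇔ c h) ⊓ (y ⇔ c k)) := by
    rw [map_inf]
    exact ⟨hh, hk⟩
  exact OrderHomClass.mono P (le_bihimp_iff_inf_eq.2 (hw h k _ (le_bihimp_iff_inf_eq.1 inf_le_left)
    (le_bihimp_iff_inf_eq.1 inf_le_right))) hz

/-- Evaluation at a prime filter as a Heyting homomorphism. -/
noncomputable def primeEvalHom (hc : IsLocallyConst c) (hP : P ⊤) :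
    HeytingHom A (Set.Iic (primeGen fun h => P (c h))) where
  toFun := primeEval hc hP
  map_sup' x y := by
    obtain ⟨h, k, e₁, e₂, e₃⟩ := primeEval_op hc hP (x := x) (y := y) (w := x ⊔ y) (· ⊔ ·)
      fun h k z h₁ h₂ => by rw [map_sup]; exact sup_inf_congr h₁ h₂
    rw [e₁, e₂, e₃, map_sup]
  map_inf' x y := by
    obtain ⟨h, k, e₁, e₂, e₃⟩ := primeEval_op hc hP (x := x) (y := y) (w := x ⊓ y) (· ⊓ ·)
      fun h k z h₁ h₂ => by rw [map_inf]; exact inf_inf_congr h₁ h₂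
    rw [e₁, e₂, e₃, map_inf]
  map_bot' := by rw [← map_bot c, primeEval_const, map_bot]
  map_himp' x y := by
    obtain ⟨h, k, e₁, e₂, e₃⟩ := primeEval_op hc hP (x := x) (y := y) (w := x ⇨ y) (· ⇨ ·)
      fun h k z h₁ h₂ => by rw [map_himp]; exact himp_inf_congr h₁ h₂
    rw [e₁, e₂, e₃, map_himp]

lemma primeEval_eq_top_iff (hc : IsLocallyConst c) (hP : P ⊤) {x : A} :
    primeEval hc hP x = ⊤ ↔ P x := by
  obtain ⟨h, hh⟩ := hc.exists_bihimp hP x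
  have e : P x ↔ P (c h) := by
    have := congrArg P (inf_bihimp_eq x (c h))
    rw [map_inf, map_inf] at this
    constructor
    · exact fun hx => (this.mp ⟨hx, hh⟩).1
    · exact fun hx => (this.mpr ⟨hx, hh⟩).1
  rw [primeEval_eq hc hP hh, e, ← primeGen_le_iff hP, Subtype.ext_iff]
  exact inf_eq_right

/-- Primality of the filter makes its generator join-prime. -/
lemma Set.Iic.sup_eq_top_iff_of_primeGen (hP : P ⊤)
    (x y : Set.Iic (primeGen fun h => P (c h))) : x ⊔ y = ⊤ ↔ x = ⊤ ∨ y = ⊤ := by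
  have key : ∀ x : Set.Iic (primeGen fun h => P (c h)), x = ⊤ ↔ P (c x) := fun x => by
    rw [← primeGen_le_iff hP, ← top_le_iff]
    rfl
  rw [key, key, key]
  change P (c ((x : H) ⊔ (y : H))) ↔ _
  rw [map_sup, map_sup]
  rfl

end Prime

end LocallyConstant

/-- Distinct elements of a distributive lattice are separated by a lattice homomorphism to
`Prop`. -/
lemma DistribLattice.exists_latticeHom_prop {D : Type*} [DistribLattice D] {x y : D}
    (h : ¬ x ≤ y) : ∃ Q : LatticeHom D Prop, Q x ∧ ¬ Q y := by
  obtain ⟨J, hJ, hle, hdisj⟩ := DistribLattice.prime_ideal_of_disjoint_filter_ideal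
    (F := Order.PFilter.principal x) (I := Order.Ideal.principal y)
    (Set.disjoint_left.2 fun z hz hz' => h (le_trans hz hz'))
  refine ⟨⟨⟨fun z => z ∉ J, fun a b => ?_⟩, fun a b => ?_⟩,
    Set.disjoint_left.1 hdisj (Order.PFilter.mem_principal.2 le_rfl), not_not.2 (hle (le_refl y))⟩
  · change (_ ∉ _) = (_ ∉ _ ∨ _ ∉ _)
    rw [Order.Ideal.sup_mem_iff, not_and_or]
  · change (_ ∉ _) = (_ ∉ _ ∧ _ ∉ _)
    refine propext ⟨fun hab => ⟨fun ha => hab (J.lower inf_le_left ha),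
      fun hb => hab (J.lower inf_le_right hb)⟩, fun hab hm => ?_⟩
    exact (hJ.mem_or_mem hm).elim hab.1 hab.2

/-! ### Étale algebras are locally constant -/

namespace HAlg

variable {H : HeytAlg.{u}}

/-- The underlying Heyting homomorphism of a morphism of `H`-algebras. -/
abbrev Hom.heyt {A B : HAlg H} (f : A ⟶ B) : HeytingHom A.right B.right := f.right.hom

lemma Hom.heyt_str {A B : HAlg H} (f : A ⟶ B) (h : H) : Hom.heyt f (A.str.hom h) = B.str.hom h :=
  congrArg (fun g : H ⟶ B.right => g.hom h) (Under.w f)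

/-- A morphism of `H`-algebras from a Heyting homomorphism that preserves the constants. -/
def homMk {A B : HAlg H} (f : HeytingHom A.right B.right)
    (hf : ∀ h, f (A.str.hom h) = B.str.hom h) : A ⟶ B :=
  Under.homMk (HeytAlg.ofHom f) (HeytAlg.ext hf)

lemma hom_ext {A B : HAlg H} {f g : A ⟶ B} (h : ∀ x, Hom.heyt f x = Hom.heyt g x) : f = g :=
  Under.UnderMorphism.ext (HeytAlg.ext h)

lemma isVariety_isLocallyConst [Fintype H] :
    IsVariety (H := H) fun A => IsLocallyConst A.str.hom where
  nonempty := ⟨self H, IsLocallyConst.id⟩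
  prod {ι} A hA x := by
    funext i
    refine Eq.trans ?_ (hA i (x i))
    exact Finset.apply_sup_eq_sup_comp (fun y : ∀ i, (A i).right => y i) (fun _ _ => rfl) rfl
  sub {A B} f hf hB x := by
    apply hf
    change Hom.heyt f _ = Hom.heyt f _
    rw [map_finset_sup, map_top, ← hB (Hom.heyt f x)]
    refine Finset.sup_congr rfl fun h _ => ?_
    rw [Function.comp_apply, map_bihimp, Hom.heyt_str]
  image {A B} f hf hA y := by
    obtain ⟨x, rfl⟩ := hf y
    change (Finset.univ.sup fun h => Hom.heyt f x ⇔ B.str.hom h) = ⊤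
    rw [← map_top (Hom.heyt f), ← hA x, map_finset_sup]
    refine Finset.sup_congr rfl fun h _ => ?_
    rw [Function.comp_apply, map_bihimp, Hom.heyt_str]

end HAlg

lemma IsEtale.isLocallyConst {H : HeytAlg.{u}} [Fintype H] {A : HAlg H} (hA : IsEtale H A) :
    IsLocallyConst A.str.hom :=
  hA _ HAlg.isVariety_isLocallyConst IsLocallyConst.id

/-! ### The coproduct of étale algebras -/

namespace HAlg

variable {H : HeytAlg.{u}}

/-- The quotient of `H` by the filter generated by `f`, as an `H`-algebra. -/
abbrev quot (f : H) : HAlg H := Under.mk (HeytAlg.ofHom (HeytingHom.toIic f))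

lemma isEtale_quot (f : H) : IsEtale H (quot f) := fun _ hP hH =>
  hP.image (A := self H) (homMk (B := quot f) (HeytingHom.toIic f) fun _ => rfl)
    (HeytingHom.toIic_surjective f) hH

variable (A B : HAlg H)

/-- Pairs of morphisms from `A` and `B` to a common quotient of `H`. -/
abbrev CommonPoint : Type u := Σ f : H, (A ⟶ quot f) × (B ⟶ quot f)

/-- The product of the quotients of `H` over all common points. -/
abbrev pointProd : HAlg H := prod fun z : CommonPoint A B => quot z.1

lemma isEtale_pointProd : IsEtale H (pointProd A B) := fun _ hP hH =>
  hP.prod _ fun z => isEtale_quot z.1 _ hP hH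

/-- Evaluation of the elements of `A` at all common points. -/
def evalLeft : HeytingHom A.right (pointProd A B).right where
  toFun x z := Hom.heyt z.2.1 x
  map_sup' x y := funext fun z => map_sup (Hom.heyt z.2.1) x y
  map_inf' x y := funext fun z => map_inf (Hom.heyt z.2.1) x y
  map_bot' := funext fun z => map_bot (Hom.heyt z.2.1)
  map_himp' x y := funext fun z => map_himp (Hom.heyt z.2.1) x y

/-- Evaluation of the elements of `B` at all common points. -/
def evalRight : HeytingHom B.right (pointProd A B).right where
  toFun x z := Hom.heyt z.2.2 x
  map_sup' x y := funext fun z => map_sup (Hom.heyt z.2.2) x y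
  map_inf' x y := funext fun z => map_inf (Hom.heyt z.2.2) x y
  map_bot' := funext fun z => map_bot (Hom.heyt z.2.2)
  map_himp' x y := funext fun z => map_himp (Hom.heyt z.2.2) x y

lemma evalLeft_str (h : H) : evalLeft A B (A.str.hom h) = (pointProd A B).str.hom h :=
  funext fun z => Hom.heyt_str z.2.1 h

lemma evalRight_str (h : H) : evalRight A B (B.str.hom h) = (pointProd A B).str.hom h :=
  funext fun z => Hom.heyt_str z.2.2 h

/-- The evaluations of the elements of `A` and of `B`. -/
def evalSet : Set (pointProd A B).right := Set.range (evalLeft A B) ∪ Set.range (evalRight A B)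

variable {A B}

lemma latticeSpan_str (h : H) : LatticeSpan (evalSet A B) ((pointProd A B).str.hom h) :=
  .of (.inl ⟨_, evalLeft_str A B h⟩)

lemma latticeSpan_bihimp_str (x : (pointProd A B).right) (hx : x ∈ evalSet A B) (h : H) :
    LatticeSpan (evalSet A B) (x ⇔ (pointProd A B).str.hom h) := by
  obtain ⟨a, rfl⟩ | ⟨b, rfl⟩ := hx
  · exact .of (.inl ⟨a ⇔ A.str.hom h, by rw [map_bihimp, evalLeft_str]⟩)
  · exact .of (.inr ⟨b ⇔ B.str.hom h, by rw [map_bihimp, evalRight_str]⟩)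

lemma latticeSpan_himp [Finite H] {x y : (pointProd A B).right}
    (hx : LatticeSpan (evalSet A B) x) (hy : LatticeSpan (evalSet A B) y) :
    LatticeSpan (evalSet A B) (x ⇨ y) := by
  have := Fintype.ofFinite H
  exact hx.himp (isEtale_pointProd A B).isLocallyConst latticeSpan_str latticeSpan_bihimp_str hy

variable (A B)

/-- The lattice generated by the evaluations of the elements of `A` and of `B`. -/
def SpanType : Type u := {x : (pointProd A B).right // LatticeSpan (evalSet A B) x}

variable {A B}

instance [Finite H] : HeytingAlgebra (SpanType A B) :=
  letI : LE (SpanType A B) := ⟨fun x y => x.1 ≤ y.1⟩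
  letI : LT (SpanType A B) := ⟨fun x y => x.1 < y.1⟩
  letI : Max (SpanType A B) := ⟨fun x y => ⟨x.1 ⊔ y.1, x.2.sup y.2⟩⟩
  letI : Min (SpanType A B) := ⟨fun x y => ⟨x.1 ⊓ y.1, x.2.inf y.2⟩⟩
  letI : Top (SpanType A B) := ⟨⟨⊤, map_top (pointProd A B).str.hom ▸ latticeSpan_str ⊤⟩⟩
  letI : Bot (SpanType A B) := ⟨⟨⊥, map_bot (pointProd A B).str.hom ▸ latticeSpan_str ⊥⟩⟩
  letI : HImp (SpanType A B) := ⟨fun x y => ⟨x.1 ⇨ y.1, latticeSpan_himp x.2 y.2⟩⟩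
  letI : Compl (SpanType A B) := ⟨fun x => x ⇨ ⊥⟩
  Function.Injective.heytingAlgebra (Subtype.val : SpanType A B → _) Subtype.val_injective
    .rfl .rfl (fun _ _ => rfl) (fun _ _ => rfl) rfl rfl (fun x => himp_bot x.1) fun _ _ => rfl

variable [Finite H]

variable (A B) in
/-- The coproduct of two étale `H`-algebras. -/
def coprodAlg : HAlg H :=
  Under.mk (Y := HeytAlg.of (SpanType A B)) <| HeytAlg.ofHom
    { toFun := fun h => ⟨(pointProd A B).str.hom h, latticeSpan_str h⟩
      map_sup' := fun x y => Subtype.ext (map_sup (pointProd A B).str.hom x y)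
      map_inf' := fun x y => Subtype.ext (map_inf (pointProd A B).str.hom x y)
      map_bot' := Subtype.ext (map_bot (pointProd A B).str.hom)
      map_himp' := fun x y => Subtype.ext (map_himp (pointProd A B).str.hom x y) }

/-- The inclusion of the coproduct in the product over all common points. -/
def coprodIncl : coprodAlg A B ⟶ pointProd A B :=
  homMk
    { toFun := fun x : SpanType A B => x.1
      map_sup' := fun _ _ => rfl
      map_inf' := fun _ _ => rfl
      map_bot' := rfl
      map_himp' := fun _ _ => rfl } fun _ => rfl

lemma isEtale_coprodAlg : IsEtale H (coprodAlg A B) := fun _ hP hH =>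
  hP.sub coprodIncl (fun _ _ h => Subtype.ext h) (isEtale_pointProd A B _ hP hH)

/-- The first injection of the coproduct. -/
def coprodInl : A ⟶ coprodAlg A B :=
  homMk (B := coprodAlg A B)
    { toFun := fun a => (⟨evalLeft A B a, .of (.inl ⟨a, rfl⟩)⟩ : SpanType A B)
      map_sup' := fun x y => Subtype.ext (map_sup (evalLeft A B) x y)
      map_inf' := fun x y => Subtype.ext (map_inf (evalLeft A B) x y)
      map_bot' := Subtype.ext (map_bot (evalLeft A B))
      map_himp' := fun x y => Subtype.ext (map_himp (evalLeft A B) x y) }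
    fun h => Subtype.ext (evalLeft_str A B h)

/-- The second injection of the coproduct. -/
def coprodInr : B ⟶ coprodAlg A B :=
  homMk (B := coprodAlg A B)
    { toFun := fun b => (⟨evalRight A B b, .of (.inr ⟨b, rfl⟩)⟩ : SpanType A B)
      map_sup' := fun x y => Subtype.ext (map_sup (evalRight A B) x y)
      map_inf' := fun x y => Subtype.ext (map_inf (evalRight A B) x y)
      map_bot' := Subtype.ext (map_bot (evalRight A B))
      map_himp' := fun x y => Subtype.ext (map_himp (evalRight A B) x y) }
    fun h => Subtype.ext (evalRight_str A B h)

lemma coprodAlg_induction {p : (coprodAlg A B).right → Prop}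
    (inl : ∀ a, p (Hom.heyt coprodInl a)) (inr : ∀ b, p (Hom.heyt coprodInr b))
    (sup : ∀ x y, p x → p y → p (x ⊔ y)) (inf : ∀ x y, p x → p y → p (x ⊓ y)) (x) : p x := by
  obtain ⟨x, hx⟩ := x
  induction hx with
  | of hx =>
    obtain ⟨a, rfl⟩ | ⟨b, rfl⟩ := hx
    · exact inl a
    · exact inr b
  | sup _ _ h₁ h₂ => exact sup _ _ h₁ h₂
  | inf _ _ h₁ h₂ => exact inf _ _ h₁ h₂

lemma coprodAlg_hom_ext {D : Type*} [Lattice D] {f g : LatticeHom (coprodAlg A B).right D}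
    (hl : ∀ a, f (Hom.heyt coprodInl a) = g (Hom.heyt coprodInl a))
    (hr : ∀ b, f (Hom.heyt coprodInr b) = g (Hom.heyt coprodInr b)) (x) : f x = g x := by
  induction x using coprodAlg_induction with
  | inl a => exact hl a
  | inr b => exact hr b
  | sup x y hx hy => rw [map_sup, map_sup, hx, hy]
  | inf x y hx hy => rw [map_inf, map_inf, hx, hy]

/-! ### The universal property among distributive lattices -/

section Desc

variable {D : Type*} [DistribLattice D] {f : LatticeHom A.right D} {g : LatticeHom B.right D}

variable (f g) in
/-- The generators of the graph of the map out of the coproduct induced by `f` and `g`. -/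
def descSet : Set ((coprodAlg A B).right × D) :=
  Set.range (fun a => (Hom.heyt coprodInl a, f a)) ∪ Set.range fun b => (Hom.heyt coprodInr b, g b)

lemma exists_latticeSpan_descSet (x : (coprodAlg A B).right) :
    ∃ y, LatticeSpan (descSet f g) (x, y) := by
  induction x using coprodAlg_induction with
  | inl a => exact ⟨f a, .of (.inl ⟨a, rfl⟩)⟩
  | inr b => exact ⟨g b, .of (.inr ⟨b, rfl⟩)⟩
  | sup x y hx hy =>
    obtain ⟨u, hu⟩ := hx
    obtain ⟨v, hv⟩ := hy
    exact ⟨u ⊔ v, hu.sup hv⟩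
  | inf x y hx hy =>
    obtain ⟨u, hu⟩ := hx
    obtain ⟨v, hv⟩ := hy
    exact ⟨u ⊓ v, hu.inf hv⟩

/-- The function underlying the map out of the coproduct induced by `f` and `g`. -/
noncomputable def coprodDescFun (x : (coprodAlg A B).right) : D :=
  (exists_latticeSpan_descSet (f := f) (g := g) x).choose

lemma coprodDescFun_spec (x : (coprodAlg A B).right) :
    LatticeSpan (descSet f g) (x, coprodDescFun (f := f) (g := g) x) :=
  (exists_latticeSpan_descSet x).choose_spec

variable (hA : IsEtale H A) (hB : IsEtale H B)
  (hfg : ∀ h, f (A.str.hom h) = g (B.str.hom h))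

include hfg in
-- `f` need not preserve `⊤`. This bound ensures that a prime filter containing some `p.2` pulls
-- back to a filter containing `⊤`.
lemma le_of_latticeSpan_descSet {p : (coprodAlg A B).right × D} (hp : LatticeSpan (descSet f g) p) :
    p.2 ≤ f ⊤ := by
  have htop : f ⊤ = g ⊤ := by
    have := hfg ⊤
    rwa [map_top A.str.hom, map_top B.str.hom] at this
  induction hp with
  | of hx =>
    obtain ⟨a, rfl⟩ | ⟨b, rfl⟩ := hx
    · exact OrderHomClass.mono f le_top
    · exact (OrderHomClass.mono g le_top).trans htop.ge
  | sup _ _ h₁ h₂ => exact sup_le h₁ h₂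
  | inf _ _ h₁ h₂ => exact inf_le_left.trans h₁

include hA hB hfg

/-- Both `Q.comp f` and `Q.comp g` restrict to the same filter of `H`, so evaluation at them gives
two morphisms to one quotient. The equivalence then spreads from generators by primality. -/
lemma exists_point (Q : LatticeHom D Prop) (hQ : Q (f ⊤)) :
    ∃ z : CommonPoint A B, ∀ p, LatticeSpan (descSet f g) p →
      ((Hom.heyt coprodIncl p.1 : ∀ z : CommonPoint A B, (quot z.1).right) z = ⊤ ↔ Q p.2) := by
  have := Fintype.ofFinite H
  have hQ' : Q (g ⊤) := by
    have := hfg ⊤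
    rw [map_top A.str.hom, map_top B.str.hom] at this
    rwa [← this]
  have hA' := hA.isLocallyConst
  have hB' := hB.isLocallyConst
  have hgen : (primeGen fun h => (Q.comp g) (B.str.hom h)) =
      primeGen fun h => (Q.comp f) (A.str.hom h) := by
    congr 1
    funext h
    exact congrArg Q (hfg h).symm
  obtain ⟨ψ, hψ⟩ : ∃ ψ : B ⟶ quot (primeGen fun h => (Q.comp f) (A.str.hom h)),
      ∀ b, Hom.heyt ψ b = ⊤ ↔ Q (g b) := by
    -- The target of `ψ` depends on the generator, so the two generators are identified before
    -- evaluating at `Q.comp g`.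
    rw [← hgen]
    exact ⟨homMk (B := quot _) (primeEvalHom (P := Q.comp g) hB' hQ') (primeEval_const hB' hQ'),
      fun b => primeEval_eq_top_iff (P := Q.comp g) hB' hQ'⟩
  refine ⟨⟨_, homMk (B := quot _) (primeEvalHom (P := Q.comp f) hA' hQ) (primeEval_const hA' hQ), ψ⟩,
    fun p hp => ?_⟩
  induction hp with
  | of hx =>
    obtain ⟨a, rfl⟩ | ⟨b, rfl⟩ := hx
    · exact primeEval_eq_top_iff (P := Q.comp f) hA' hQ
    · exact hψ b
  | sup _ _ h₁ h₂ =>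
    rw [Prod.snd_sup, map_sup]
    refine Iff.trans ?_ (or_congr h₁ h₂)
    exact Set.Iic.sup_eq_top_iff_of_primeGen (P := Q.comp f) (c := A.str.hom) hQ _ _
  | inf _ _ h₁ h₂ =>
    rw [Prod.snd_inf, map_inf]
    refine Iff.trans ?_ (and_congr h₁ h₂)
    exact inf_eq_top_iff

lemma descSet_mono {p q : (coprodAlg A B).right × D} (hp : LatticeSpan (descSet f g) p)
    (hq : LatticeSpan (descSet f g) q) (hpq : p.1 ≤ q.1) : p.2 ≤ q.2 := by
  by_contra hne
  obtain ⟨Q, hQp, hQq⟩ := DistribLattice.exists_latticeHom_prop hne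
  obtain ⟨z, hz⟩ := exists_point hA hB hfg Q
    (OrderHomClass.mono Q (le_of_latticeSpan_descSet hfg hp) hQp)
  refine hQq ((hz q hq).1 (top_le_iff.1 (((hz p hp).2 hQp).ge.trans ?_)))
  exact hpq z

/-- Monotonicity in both directions makes the relation single-valued, so the choice in
`coprodDescFun` is harmless. -/
lemma coprodDescFun_eq {x : (coprodAlg A B).right} {y : D}
    (h : LatticeSpan (descSet f g) (x, y)) : coprodDescFun (f := f) (g := g) x = y :=
  le_antisymm (descSet_mono hA hB hfg (coprodDescFun_spec x) h le_rfl)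
    (descSet_mono hA hB hfg h (coprodDescFun_spec x) le_rfl)

/-- The lattice homomorphism out of the coproduct induced by `f` and `g`. -/
noncomputable def coprodDesc : LatticeHom (coprodAlg A B).right D where
  toFun := coprodDescFun (f := f) (g := g)
  map_sup' x y :=
    coprodDescFun_eq hA hB hfg ((coprodDescFun_spec x).sup (coprodDescFun_spec y))
  map_inf' x y :=
    coprodDescFun_eq hA hB hfg ((coprodDescFun_spec x).inf (coprodDescFun_spec y))

lemma coprodDesc_inl (a : A.right) : coprodDesc hA hB hfg (Hom.heyt coprodInl a) = f a :=
  coprodDescFun_eq hA hB hfg (.of (.inl ⟨a, rfl⟩))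

lemma coprodDesc_inr (b : B.right) : coprodDesc hA hB hfg (Hom.heyt coprodInr b) = g b :=
  coprodDescFun_eq hA hB hfg (.of (.inr ⟨b, rfl⟩))

end Desc

end HAlg

/-! ### The universal property among étale algebras -/

namespace HAlg

variable {H : HeytAlg.{u}} {A B C : HAlg H}

/-- The lattice homomorphism underlying a morphism of `H`-algebras. -/
def Hom.lat (f : A ⟶ C) : LatticeHom A.right C.right := (Hom.heyt f : LatticeHom A.right C.right)

lemma Hom.lat_compat (f : A ⟶ C) (g : B ⟶ C) (h : H) :
    Hom.lat f (A.str.hom h) = Hom.lat g (B.str.hom h) :=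
  (Hom.heyt_str f h).trans (Hom.heyt_str g h).symm

variable [Finite H]

/-- The product of the coproduct with `C` is again locally constant, so `LatticeSpan.himp` applies
to the graph itself. -/
lemma latticeSpan_descSet_himp (hC : IsEtale H C) (f : A ⟶ C) (g : B ⟶ C)
    {p q : (coprodAlg A B).right × C.right}
    (hp : LatticeSpan (descSet (Hom.lat f) (Hom.lat g)) p)
    (hq : LatticeSpan (descSet (Hom.lat f) (Hom.lat g)) q) :
    LatticeSpan (descSet (Hom.lat f) (Hom.lat g)) (p ⇨ q) := by
  have := Fintype.ofFinite H
  have el : ∀ h, (Hom.heyt (coprodInl (B := B)) (A.str.hom h), Hom.heyt f (A.str.hom h)) =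
      (coprodAlg A B).str.hom.pair C.str.hom h := fun h =>
    Prod.ext (Hom.heyt_str _ h) (Hom.heyt_str _ h)
  have er : ∀ h, (Hom.heyt (coprodInr (A := A)) (B.str.hom h), Hom.heyt g (B.str.hom h)) =
      (coprodAlg A B).str.hom.pair C.str.hom h := fun h =>
    Prod.ext (Hom.heyt_str _ h) (Hom.heyt_str _ h)
  refine hp.himp (isEtale_coprodAlg.isLocallyConst.pair hC.isLocallyConst)
    (fun h => .of (.inl ⟨A.str.hom h, el h⟩)) ?_ hq
  rintro _ (⟨a, rfl⟩ | ⟨b, rfl⟩) h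
  · refine .of (.inl ⟨a ⇔ A.str.hom h, ?_⟩)
    rw [← el]
    exact Prod.ext (map_bihimp (Hom.heyt coprodInl) _ _) (map_bihimp (Hom.heyt f) _ _)
  · refine .of (.inr ⟨b ⇔ B.str.hom h, ?_⟩)
    rw [← er]
    exact Prod.ext (map_bihimp (Hom.heyt coprodInr) _ _) (map_bihimp (Hom.heyt g) _ _)

/-- The morphism of `H`-algebras out of the coproduct induced by `f` and `g`. -/
noncomputable def coprodDescHom (hA : IsEtale H A) (hB : IsEtale H B) (hC : IsEtale H C)
    (f : A ⟶ C) (g : B ⟶ C) : coprodAlg A B ⟶ C :=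
  homMk
    { toFun := coprodDesc hA hB (Hom.lat_compat f g)
      map_sup' := map_sup _
      map_inf' := map_inf _
      map_bot' := by
        rw [← map_bot (Hom.heyt (coprodInl (A := A) (B := B))), coprodDesc_inl]
        exact map_bot (Hom.heyt f)
      map_himp' := fun x y => coprodDescFun_eq hA hB (Hom.lat_compat f g)
        (latticeSpan_descSet_himp hC f g (coprodDescFun_spec x) (coprodDescFun_spec y)) }
    fun h => by
      rw [← Hom.heyt_str coprodInl h]
      exact (coprodDesc_inl hA hB (Hom.lat_compat f g) _).trans (Hom.heyt_str f h)

end HAlg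

/-! ### Coproduct cofans and pushout squares -/

namespace EtaleAlg

open HAlg

variable {H : HeytAlg.{u}} [Finite H] (c₁ c₂ : EtaleAlg H)

/-- The coproduct cofan of two étale `H`-algebras. -/
def coprodCofan : BinaryCofan c₁ c₂ :=
  BinaryCofan.mk (P := (⟨coprodAlg c₁.obj c₂.obj, isEtale_coprodAlg⟩ : EtaleAlg H))
    (ObjectProperty.homMk coprodInl) (ObjectProperty.homMk coprodInr)

/-- The coproduct cofan is a colimit. -/
noncomputable def isColimitCoprodCofan : IsColimit (coprodCofan c₁ c₂) :=
  BinaryCofan.IsColimit.mk _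
    (fun {T} f g => ObjectProperty.homMk
      (coprodDescHom c₁.property c₂.property T.property f.hom g.hom))
    (fun f g => ObjectProperty.hom_ext _ (HAlg.hom_ext fun a =>
      coprodDesc_inl c₁.property c₂.property (Hom.lat_compat f.hom g.hom) a))
    (fun f g => ObjectProperty.hom_ext _ (HAlg.hom_ext fun b =>
      coprodDesc_inr c₁.property c₂.property (Hom.lat_compat f.hom g.hom) b))
    (fun {T} f g m hl hr => ObjectProperty.hom_ext _ (HAlg.hom_ext fun x => by
      subst hl hr
      refine coprodAlg_hom_ext (f := Hom.lat m.hom)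
        (g := Hom.lat (coprodDescHom c₁.property c₂.property T.property _ _)) (fun a => ?_) (fun b => ?_) x
      · exact (coprodDesc_inl c₁.property c₂.property (Hom.lat_compat
          ((coprodCofan c₁ c₂).inl ≫ m).hom ((coprodCofan c₁ c₂).inr ≫ m).hom) a).symm
      · exact (coprodDesc_inr c₁.property c₂.property (Hom.lat_compat
          ((coprodCofan c₁ c₂).inl ≫ m).hom ((coprodCofan c₁ c₂).inr ≫ m).hom) b).symm))

lemma coprod_comm (h : H) : Hom.heyt (coprodInl (B := c₂.obj)) (c₁.obj.str.hom h) =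
    Hom.heyt (coprodInr (A := c₁.obj)) (c₂.obj.str.hom h) :=
  (Hom.heyt_str _ h).trans (Hom.heyt_str _ h).symm

/-- The coproduct of étale algebras is a pushout of bounded distributive lattices. -/
lemma isPushout_bddDistLat : IsPushout c₁.latStr c₂.latStr
    ((toBddDistLat H).map (coprodCofan c₁ c₂).inl)
    ((toBddDistLat H).map (coprodCofan c₁ c₂).inr) := by
  have hc (s : PushoutCocone c₁.latStr c₂.latStr) (h : H) :
      s.inl.hom.toLatticeHom (c₁.obj.str.hom h) = s.inr.hom.toLatticeHom (c₂.obj.str.hom h) :=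
    congrArg (fun k => BddDistLat.Hom.hom k h) s.condition
  let d (s : PushoutCocone c₁.latStr c₂.latStr) : LatticeHom (coprodAlg c₁.obj c₂.obj).right s.pt :=
    coprodDesc (f := s.inl.hom.toLatticeHom) (g := s.inr.hom.toLatticeHom) c₁.property c₂.property (hc s)
  have hl (s) (a : c₁.obj.right) : d s (Hom.heyt coprodInl a) = s.inl.hom a :=
    coprodDesc_inl _ _ _ a
  have hr (s) (b : c₂.obj.right) : d s (Hom.heyt coprodInr b) = s.inr.hom b :=
    coprodDesc_inr _ _ _ b
  let d' (s : PushoutCocone c₁.latStr c₂.latStr) : BoundedLatticeHom (coprodAlg c₁.obj c₂.obj).right s.pt :=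
    { d s with
      map_top' := (congrArg (d s) (map_top (Hom.heyt coprodInl)).symm).trans
        ((hl s ⊤).trans (map_top s.inl.hom))
      map_bot' := (congrArg (d s) (map_bot (Hom.heyt coprodInl)).symm).trans
        ((hl s ⊥).trans (map_bot s.inl.hom)) }
  exact ⟨⟨BddDistLat.ext (coprod_comm c₁ c₂)⟩, ⟨PushoutCocone.IsColimit.mk _
    (fun s => BddDistLat.ofHom (X := (coprodAlg c₁.obj c₂.obj).right) (d' s))
    (fun s => BddDistLat.ext (hl s)) (fun s => BddDistLat.ext (hr s))
    (fun s m ml mr => BddDistLat.ext <| coprodAlg_hom_ext (f := m.hom.toLatticeHom) (g := d s)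
      (fun a => (congrArg (fun k => BddDistLat.Hom.hom k a) ml).trans (hl s a).symm)
      (fun b => (congrArg (fun k => BddDistLat.Hom.hom k b) mr).trans (hr s b).symm))⟩⟩

/-- The coproduct of étale algebras is a pushout of distributive lattices. -/
lemma isPushout_distLat : IsPushout ((forget₂ BddDistLat DistLat).map c₁.latStr)
    ((forget₂ BddDistLat DistLat).map c₂.latStr)
    ((forget₂ BddDistLat DistLat).map ((toBddDistLat H).map (coprodCofan c₁ c₂).inl))
    ((forget₂ BddDistLat DistLat).map ((toBddDistLat H).map (coprodCofan c₁ c₂).inr)) := by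
  have hc (s : PushoutCocone ((forget₂ BddDistLat DistLat).map c₁.latStr)
      ((forget₂ BddDistLat DistLat).map c₂.latStr)) (h : H) :
      s.inl.hom (c₁.obj.str.hom h) = s.inr.hom (c₂.obj.str.hom h) :=
    congrArg (fun k => DistLat.Hom.hom k h) s.condition
  let d (s : PushoutCocone ((forget₂ BddDistLat DistLat).map c₁.latStr)
      ((forget₂ BddDistLat DistLat).map c₂.latStr)) : LatticeHom (coprodAlg c₁.obj c₂.obj).right s.pt :=
    coprodDesc (f := s.inl.hom) (g := s.inr.hom) c₁.property c₂.property (hc s)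
  have hl (s) (a : c₁.obj.right) : d s (Hom.heyt coprodInl a) = s.inl.hom a :=
    coprodDesc_inl _ _ _ a
  have hr (s) (b : c₂.obj.right) : d s (Hom.heyt coprodInr b) = s.inr.hom b :=
    coprodDesc_inr _ _ _ b
  exact ⟨⟨DistLat.ext (coprod_comm c₁ c₂)⟩, ⟨PushoutCocone.IsColimit.mk _
    (fun s => DistLat.ofHom (X := (coprodAlg c₁.obj c₂.obj).right) (d s))
    (fun s => DistLat.ext (hl s)) (fun s => DistLat.ext (hr s))
    (fun s m ml mr => DistLat.ext <| coprodAlg_hom_ext (f := m.hom) (g := d s)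
      (fun a => (congrArg (fun k => DistLat.Hom.hom k a) ml).trans (hl s a).symm)
      (fun b => (congrArg (fun k => DistLat.Hom.hom k b) mr).trans (hr s b).symm))⟩⟩

/-- A functor that sends the injections of one coproduct to a pushout does so for every
coproduct. -/
lemma isPushout_map_of_isColimit {C D : Type*} [Category* C] [Category* D] (F : C ⥤ D) {X Y : C}
    {s t : BinaryCofan X Y} (hs : IsColimit s) (ht : IsColimit t) {Z : D} {f : Z ⟶ F.obj X}
    {g : Z ⟶ F.obj Y} (h : IsPushout f g (F.map s.inl) (F.map s.inr)) :
    IsPushout f g (F.map t.inl) (F.map t.inr) := by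
  refine h.of_iso (Iso.refl _) (Iso.refl _) (Iso.refl _)
    (F.mapIso (hs.coconePointUniqueUpToIso ht)) (by simp) (by simp) ?_ ?_
  · have := hs.comp_coconePointUniqueUpToIso_hom ht ⟨WalkingPair.left⟩
    exact (F.map_comp _ _).symm.trans ((congrArg F.map this).trans (Category.id_comp _).symm)
  · have := hs.comp_coconePointUniqueUpToIso_hom ht ⟨WalkingPair.right⟩
    exact (F.map_comp _ _).symm.trans ((congrArg F.map this).trans (Category.id_comp _).symm)

end EtaleAlg

/-- Over a finite Heyting algebra `H`, any two étale `H`-algebras have a coproduct in the category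
of étale `H`-algebras, and every such coproduct, with its two injections, is the pushout of the
structure maps, both among bounded distributive lattices (with bounded lattice homomorphisms) and
among distributive lattices (with all lattice homomorphisms). -/
theorem mainTheorem7 (H : HeytAlg.{u}) [Finite H] (c₁ c₂ : EtaleAlg H) :
    HasBinaryCoproduct c₁ c₂ ∧
    ∀ (s : BinaryCofan c₁ c₂), Nonempty (IsColimit s) →
      IsPushout c₁.latStr c₂.latStr
        ((EtaleAlg.toBddDistLat H).map s.inl) ((EtaleAlg.toBddDistLat H).map s.inr) ∧
      IsPushout ((forget₂ BddDistLat DistLat).map c₁.latStr)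
        ((forget₂ BddDistLat DistLat).map c₂.latStr)
        ((forget₂ BddDistLat DistLat).map ((EtaleAlg.toBddDistLat H).map s.inl))
        ((forget₂ BddDistLat DistLat).map ((EtaleAlg.toBddDistLat H).map s.inr)) := by
  refine ⟨HasColimit.mk ⟨_, EtaleAlg.isColimitCoprodCofan c₁ c₂⟩, fun s ⟨hs⟩ => ⟨?_, ?_⟩⟩
  · exact EtaleAlg.isPushout_map_of_isColimit (EtaleAlg.toBddDistLat H)
      (EtaleAlg.isColimitCoprodCofan c₁ c₂) hs (EtaleAlg.isPushout_bddDistLat c₁ c₂)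
  · exact EtaleAlg.isPushout_map_of_isColimit (EtaleAlg.toBddDistLat H ⋙ forget₂ BddDistLat DistLat)
      (EtaleAlg.isColimitCoprodCofan c₁ c₂) hs (EtaleAlg.isPushout_distLat c₁ c₂)
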